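/- Let $m,p\ge 1$. An $m\times p$ \emph{Cauchon diagram} $C$ is an $m\times p$ grid of boxes $(i,\alpha)$, $1\le i\le m$, $1\le\alpha\le p$ (row $i$, column $\alpha$), some of which are coloured black (the others are white), such that whenever a box is black, either all boxes strictly to its left in its row are black or all boxes strictly above it in its column are black. We write $(i,\alpha)\in C$ if $(i,\alpha)$ is black. \emph{Cauchon reduction.} For a real $m\times p$ matrix $M$, run through the boxes $(j,\beta)\neq(1,1)$ in decreasing lexicographic order, starting with the matrix $M$. At the box $(j,\beta)$, if the current matrix is $(x_{i,\alpha})$ and $x_{j,\beta}\ne 0$, replace $x_{i,\alpha}$ by $x_{i,\alpha}-x_{i,\beta}x_{j,\beta}^{-1}x_{j,\alpha}$ for all $i<j$, $\alpha<\beta$ and leave the other entries unchanged; if $x_{j,\beta}=0$, change nothing. The final matrix is denoted $\widetilde M=(t_{i,\alpha})$. A real matrix is \emph{totally nonnegative} (tnn) if all its minors are $\ge 0$; here $[i_0\dots i_t\,|\,\alpha_0\dots\alpha_t](M)$ is the minor of $M$ with rows $i_0<\dots<i_t$ and columns $\alpha_0<\dots<\alpha_t$. For a Cauchon diagram $C$,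 the tnn cell $S^0_C$ is the set of tnn $m\times p$ matrices $M$ such that, for all $(i,\alpha)$, $t_{i,\alpha}=0$ if and only if $(i,\alpha)\in C$. A sequence of boxes $((i_0,\alpha_0),\dots,(i_t,\alpha_t))$ is \emph{lacunary} with respect to $C$ if 1. $t\ge 0$; 2. the boxes $(i_1,\alpha_1),\dots,(i_t,\alpha_t)$ are white; 3. $1\le i_0<\dots<i_t\le m$ and $1\le\alpha_0<\dots<\alpha_t\le p$; 4. every box $(i,\alpha)$ with $i>i_t$ and $\alpha>\alpha_t$ is black; 5. for each $s\in\{0,\dots,t-1\}$, either all boxes $(i,\alpha)$ with $i_s<i<i_{s+1}$ and $\alpha_s<\alpha$ are black, or all boxes $(i,\alpha)$ with $i_s<i<i_{s+1}$ and $\alpha_0\le\alpha<\alpha_{s+1}$ are black; 6. for each $s\in\{0,\dots,t-1\}$, either all boxes $(i,\alpha)$ with $i_s<i$ and $\alpha_s<\alpha<\alpha_{s+1}$ are black, or all boxes $(i,\alpha)$ with $i<i_{s+1}$ and $\alpha_s<\alpha<\alpha_{s+1}$ are black. **Proposition.** Let $C$ be an $m\times p$ Cauchon diagram and $M$ a real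 $m\times p$ matrix. For every box $(j,\beta)$ fix a lacunary sequence $((j_0,\beta_0),\dots,(j_d,\beta_d))$ with respect to $C$ with $(j_0,\beta_0)=(j,\beta)$, and put $\Delta^C_{j,\beta}(M)=[j_0\dots j_d\,|\,\beta_0\dots\beta_d](M)$. Suppose that one of the following holds: (a) $M$ is tnn and $M\in S^0_C$; (b) for every box $(j,\beta)$, $\Delta^C_{j,\beta}(M)=0$ if $(j,\beta)\in C$, and $\Delta^C_{j,\beta}(M)>0$ if $(j,\beta)\notin C$. Then for every lacunary sequence $((i_0,\alpha_0),\dots,(i_t,\alpha_t))$ with respect to $C$, $$[i_0\dots i_t\,|\,\alpha_0\dots\alpha_t](M)=t_{i_0,\alpha_0}t_{i_1,\alpha_1}\cdots t_{i_t,\alpha_t}.$$ Moreover, under (b), every $t_{i,\alpha}$ is $\ge 0$, and $t_{i,\alpha}=0$ if and only if $(i,\alpha)\in C$. -/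

import Mathlib

namespace TNNCells

/-- An `m × p` Cauchon diagram: a set of black boxes (rows and columns indexed from `0`) such that,
whenever a box is black, all boxes strictly to its left or all boxes strictly above it are black. -/
structure CauchonDiagram (m p : ℕ) where
  black : Set (Fin m × Fin p)
  left_or_above : ∀ i α, (i, α) ∈ black →
    (∀ γ, γ < α → (i, γ) ∈ black) ∨ (∀ k, k < i → (k, α) ∈ black)

/-- A real matrix is totally nonnegative if all its minors are nonnegative. -/
def IsTNN {m p : ℕ} (M : Matrix (Fin m) (Fin p) ℝ) : Prop :=
  ∀ (k : ℕ) (r : Fin k → Fin m) (c : Fin k → Fin p), StrictMono r → StrictMono c →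
    0 ≤ (M.submatrix r c).det

/-- `X` is a Cauchon matrix associated to `C`: its zero entries are exactly at the black boxes. -/
def IsCauchonMatrix {m p : ℕ} (C : CauchonDiagram m p) (X : Matrix (Fin m) (Fin p) ℝ) : Prop :=
  ∀ i α, X i α = 0 ↔ (i, α) ∈ C.black

open Classical in
/-- One step of the Cauchon reduction algorithm, with pivot at the box `b = (j, β)`. -/
noncomputable def reductionStep {m p : ℕ} (b : Fin m × Fin p) (X : Matrix (Fin m) (Fin p) ℝ) :
    Matrix (Fin m) (Fin p) ℝ :=
  if X b.1 b.2 = 0 then X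
  else Matrix.of fun i α =>
    if i < b.1 ∧ α < b.2 then X i α - X i b.2 * (X b.1 b.2)⁻¹ * X b.1 α else X i α

/-- All boxes of the `m × p` grid, listed in increasing lexicographic order. -/
def boxes (m p : ℕ) : List (Fin m × Fin p) :=
  List.product (List.finRange m) (List.finRange p)

/-- The matrix obtained at the end of the Cauchon reduction algorithm: starting from `M`, the
reduction steps are applied at all boxes in decreasing lexicographic order (last box first).
The step at the top left box changes nothing, so it does no harm to include it. -/
noncomputable def cauchonReduction {m p : ℕ} (M : Matrix (Fin m) (Fin p) ℝ) :
    Matrix (Fin m) (Fin p) ℝ :=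
  (boxes m p).foldr reductionStep M

/-- The totally nonnegative cell associated to `C`: the totally nonnegative matrices whose
Cauchon reduction is a Cauchon matrix associated to `C`. -/
def tnnCell {m p : ℕ} (C : CauchonDiagram m p) : Set (Matrix (Fin m) (Fin p) ℝ) :=
  {M | IsTNN M ∧ IsCauchonMatrix C (cauchonReduction M)}

/-- A lacunary sequence `((i_0, α_0), …, (i_t, α_t))` with respect to the Cauchon diagram `C`,
where `i_s = row s` and `α_s = col s`. -/
structure LacunarySeq {m p : ℕ} (C : CauchonDiagram m p) where
  t : ℕ
  row : Fin (t + 1) → Fin m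
  col : Fin (t + 1) → Fin p
  white : ∀ s : Fin (t + 1), s ≠ 0 → (row s, col s) ∉ C.black
  row_strictMono : StrictMono row
  col_strictMono : StrictMono col
  black_after : ∀ i α, row (Fin.last t) < i → col (Fin.last t) < α → (i, α) ∈ C.black
  black_rows : ∀ s : Fin t,
    (∀ i α, row s.castSucc < i → i < row s.succ → col s.castSucc < α → (i, α) ∈ C.black) ∨
    (∀ i α, row s.castSucc < i → i < row s.succ → col 0 ≤ α → α < col s.succ →
      (i, α) ∈ C.black)
  black_cols : ∀ s : Fin t,
    (∀ i α, row s.castSucc < i → col s.castSucc < α → α < col s.succ → (i, α) ∈ C.black) ∨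
    (∀ i α, i < row s.succ → col s.castSucc < α → α < col s.succ → (i, α) ∈ C.black)

/-- The lacunary sequence starts at the box `(j, β)`. -/
def LacunarySeq.StartsAt {m p : ℕ} {C : CauchonDiagram m p} (L : LacunarySeq C)
    (j : Fin m) (β : Fin p) : Prop :=
  L.row 0 = j ∧ L.col 0 = β

/-- The minor `[i_0, …, i_t | α_0, …, α_t](M)` attached to a lacunary sequence. -/
def LacunarySeq.minor {m p : ℕ} {C : CauchonDiagram m p} (L : LacunarySeq C)
    (M : Matrix (Fin m) (Fin p) ℝ) : ℝ :=
  (M.submatrix L.row L.col).det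

/-- For the chosen lacunary sequences `L j β`, the minor of `M` attached to `L j β` is zero if
`(j, β)` is black and positive if `(j, β)` is white. -/
def HasMinorPattern {m p : ℕ} {C : CauchonDiagram m p} (L : Fin m → Fin p → LacunarySeq C)
    (M : Matrix (Fin m) (Fin p) ℝ) : Prop :=
  ∀ j β, ((j, β) ∈ C.black → (L j β).minor M = 0) ∧ ((j, β) ∉ C.black → 0 < (L j β).minor M)

end TNNCells

/-!
Undoing the reduction steps with pivots in row `j` maps a row `y` above it to
`α ↦ y α + t j α * ∑_{β > α} y β / t j β`. This operator is upper triangular, and row `i` of `M`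
arises from row `i` of the reduced matrix `t` by applying it for `j = i + 1, …, m` in turn.

For a lacunary sequence ending at `(k, c)`, the black boxes after `(k, c)` allow the columns after
`c` to be cut off once row `k` has been restored. In the truncated minor the last column of the last
row is the pivot `t k c`. Clearing the rest of that column replaces the restoration by row `k` of
the rows above by the restoration of their parts before column `c`; lacunarity then turns this into
the truncated minor of the sequence without its last box. So the pivots split off one by one.

Conversely, by decreasing induction on boxes, the product formula for the chosen sequence at
`(j, β)` determines `t j β`, since it involves only `t j β` and nonzero later entries.
-/

namespace TNNCells

section LacunaryChain

variable {ι K : Type*} [Preorder ι] [Zero K]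

/-- The vanishing pattern of the rows `τ` along the boxes `(row s, col s)` that lacunarity of these
boxes amounts to when `τ` vanishes exactly at the black boxes. The condition on the boxes to the
right of and below the last one is left out, so that initial segments inherit the pattern. -/
structure IsLacunaryChain (τ : ℕ → ι → K) {t : ℕ} (row : Fin (t + 1) → ℕ)
    (col : Fin (t + 1) → ι) : Prop where
  row_strictMono : StrictMono row
  col_strictMono : StrictMono col
  ne_zero : ∀ s, s ≠ 0 → τ (row s) (col s) ≠ 0
  zero_rows : ∀ s : Fin t,
    (∀ j β, row s.castSucc < j → j < row s.succ → col s.castSucc < β → τ j β = 0) ∨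
    (∀ j β, row s.castSucc < j → j < row s.succ → col 0 ≤ β → β < col s.succ → τ j β = 0)
  zero_cols : ∀ s : Fin t,
    (∀ j β, row s.castSucc < j → col s.castSucc < β → β < col s.succ → τ j β = 0) ∨
    (∀ j β, row 0 ≤ j → j < row s.succ → col s.castSucc < β → β < col s.succ → τ j β = 0)

namespace IsLacunaryChain

theorem castSucc {τ : ℕ → ι → K} {t : ℕ} {row : Fin (t + 2) → ℕ} {col : Fin (t + 2) → ι}
    (h : IsLacunaryChain τ row col) :
    IsLacunaryChain τ (fun s : Fin (t + 1) => row s.castSucc) fun s => col s.castSucc where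
  row_strictMono := h.row_strictMono.comp Fin.strictMono_castSucc
  col_strictMono := h.col_strictMono.comp Fin.strictMono_castSucc
  ne_zero _ hs := h.ne_zero _ (Fin.castSucc_ne_zero_iff.2 hs)
  zero_rows _ := h.zero_rows _
  zero_cols _ := h.zero_cols _

end IsLacunaryChain

end LacunaryChain

section Restoration

variable {ι K : Type*} [LinearOrder ι] [LocallyFiniteOrderTop ι] [Field K]

/-- The inverse of the reduction steps with pivots in a row `t`, acting on a row above it.
The columns where `t` vanishes do not contribute, since `0⁻¹ = 0`. -/
def restoreRow (t : ι → K) : Module.End K (ι → K) where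
  toFun y α := y α + t α * ∑ β ∈ Finset.Ioi α, y β * (t β)⁻¹
  map_add' y z := by
    ext α
    simp only [Pi.add_apply, add_mul, Finset.sum_add_distrib]
    ring
  map_smul' c y := by
    ext α
    simp only [Pi.smul_apply, smul_eq_mul, RingHom.id_apply, mul_assoc, ← Finset.mul_sum]
    ring

theorem restoreRow_apply (t y : ι → K) (α : ι) :
    restoreRow t y α = y α + t α * ∑ β ∈ Finset.Ioi α, y β * (t β)⁻¹ := rfl

theorem restoreRow_congr (t : ι → K) {y z : ι → K} {α : ι} (h : ∀ β, α ≤ β → y β = z β) :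
    restoreRow t y α = restoreRow t z α := by
  have hsum : ∑ β ∈ Finset.Ioi α, y β * (t β)⁻¹ = ∑ β ∈ Finset.Ioi α, z β * (t β)⁻¹ :=
    Finset.sum_congr rfl fun β hβ => by rw [h β (Finset.mem_Ioi.1 hβ).le]
  rw [restoreRow_apply, restoreRow_apply, h α le_rfl, hsum]

theorem restoreRow_apply_of_forall_gt (t : ι → K) {y : ι → K} {α : ι}
    (h : ∀ β, α < β → y β = 0) : restoreRow t y α = y α := by
  rw [restoreRow_apply, Finset.sum_eq_zero, mul_zero, add_zero]
  exact fun β hβ => by rw [h β (Finset.mem_Ioi.1 hβ), zero_mul]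

theorem restoreRow_apply_of_eq_zero {t : ι → K} {α : ι} (h : t α = 0) (y : ι → K) :
    restoreRow t y α = y α := by
  rw [restoreRow_apply, h, zero_mul, add_zero]

theorem restoreRow_eq_self {t y : ι → K} (h : ∀ β, y β = 0 ∨ t β = 0) : restoreRow t y = y := by
  ext α
  rw [restoreRow_apply, Finset.sum_eq_zero, mul_zero, add_zero]
  intro β _
  rcases h β with h | h <;> simp [h]

theorem restoreRow_apply_mul_inv {t : ι → K} {c : ι} (hc : t c ≠ 0) (z : ι → K) :
    restoreRow t z c * (t c)⁻¹ = ∑ β ∈ Finset.Ici c, z β * (t β)⁻¹ := by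
  rw [restoreRow_apply, ← Finset.add_sum_Ioi_eq_sum_Ici]
  field_simp

theorem restoreRow_indicator_Ici_apply (t z : ι → K) {α c : ι} (h : α < c) :
    restoreRow t ((Set.Ici c).indicator z) α = t α * ∑ β ∈ Finset.Ici c, z β * (t β)⁻¹ := by
  rw [restoreRow_apply, Set.indicator_of_notMem (Set.notMem_Ici.2 h), zero_add]
  rw [← Finset.coe_Ici, Finset.sum_indicator_subset_of_eq_zero z (fun β x => x * (t β)⁻¹) _
    fun β => zero_mul _]
  exact fun β hβ => Finset.mem_Ioi.2 (h.trans_le (Finset.mem_Ici.1 hβ))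

theorem indicator_restoreRow_sub {t : ι → K} {c : ι} (hc : t c ≠ 0) (z : ι → K) :
    (Set.Iic c).indicator (restoreRow t z) -
        (restoreRow t z c * (t c)⁻¹) • (Set.Iic c).indicator t =
      restoreRow t ((Set.Iio c).indicator z) := by
  ext α
  simp only [Pi.sub_apply, Pi.smul_apply, smul_eq_mul]
  have hzero (hα : c ≤ α) : restoreRow t ((Set.Iio c).indicator z) α = 0 := by
    rw [restoreRow_congr t (z := 0), map_zero, Pi.zero_apply]
    exact fun β hβ => Set.indicator_of_notMem (Set.notMem_Iio.2 (hα.trans hβ)) _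
  rcases lt_trichotomy α c with h | rfl | h
  · have hz : z = (Set.Iio c).indicator z + (Set.Ici c).indicator z := by
      rw [← Set.compl_Iio, Set.indicator_self_add_compl]
    have hsplit : restoreRow t z α = restoreRow t ((Set.Iio c).indicator z) α +
        t α * ∑ β ∈ Finset.Ici c, z β * (t β)⁻¹ := by
      rw [← restoreRow_indicator_Ici_apply t z h, ← Pi.add_apply, ← map_add, ← hz]
    rw [Set.indicator_of_mem (Set.mem_Iic.2 h.le), Set.indicator_of_mem (Set.mem_Iic.2 h.le),
      restoreRow_apply_mul_inv hc, hsplit, mul_comm (t α), add_sub_cancel_right]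
  · rw [hzero le_rfl, Set.indicator_of_mem Set.self_mem_Iic, Set.indicator_of_mem Set.self_mem_Iic,
      inv_mul_cancel_right₀ hc, sub_self]
  · rw [hzero h.le, Set.indicator_of_notMem (Set.notMem_Iic.2 h),
      Set.indicator_of_notMem (Set.notMem_Iic.2 h), mul_zero, sub_self]

/-- The composition of the restorations by the rows `τ k, …, τ (l - 1)`, in this order. For a
row above them, it undoes all reduction steps with pivots in these rows. -/
def restoreRows (τ : ℕ → ι → K) (k l : ℕ) : Module.End K (ι → K) :=
  ((List.Ico k l).map fun j => restoreRow (τ j)).reverse.prod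

variable (τ : ℕ → ι → K)

theorem restoreRows_self (k : ℕ) (y : ι → K) : restoreRows τ k k y = y := by
  simp [restoreRows]

theorem restoreRows_succ {k l : ℕ} (h : k ≤ l) (y : ι → K) :
    restoreRows τ k (l + 1) y = restoreRow (τ l) (restoreRows τ k l y) := by
  simp [restoreRows, List.Ico.succ_top h]

theorem restoreRows_restoreRows {k l n : ℕ} (hkl : k ≤ l) (hln : l ≤ n) (y : ι → K) :
    restoreRows τ l n (restoreRows τ k l y) = restoreRows τ k n y := by
  simp [restoreRows, ← List.Ico.append_consecutive hkl hln]

theorem restoreRows_eq_restoreRow {k l : ℕ} (h : k < l) (y : ι → K) :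
    restoreRows τ k l y = restoreRows τ (k + 1) l (restoreRow (τ k) y) := by
  simp [restoreRows, List.Ico.eq_cons h]

variable {τ}

theorem restoreRows_congr {k l : ℕ} (h : k ≤ l) {y z : ι → K} {α : ι}
    (hyz : ∀ β, α ≤ β → y β = z β) : restoreRows τ k l y α = restoreRows τ k l z α := by
  induction l, h using Nat.le_induction generalizing α with
  | base => simpa only [restoreRows_self] using hyz α le_rfl
  | succ l hl ih =>
    rw [restoreRows_succ τ hl, restoreRows_succ τ hl]
    exact restoreRow_congr _ fun β hβ => ih fun γ hγ => hyz γ (hβ.trans hγ)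

theorem restoreRows_apply_eq_zero {k l : ℕ} (h : k ≤ l) {y : ι → K} {α : ι}
    (hy : ∀ β, α ≤ β → y β = 0) : restoreRows τ k l y α = 0 := by
  rw [restoreRows_congr h (z := 0) hy, map_zero, Pi.zero_apply]

theorem restoreRows_apply_of_forall_gt {k l : ℕ} (h : k ≤ l) {y : ι → K} {α : ι}
    (hy : ∀ β, α < β → y β = 0) : restoreRows τ k l y α = y α := by
  induction l, h using Nat.le_induction with
  | base => rw [restoreRows_self]
  | succ l hl ih =>
    rw [restoreRows_succ τ hl, restoreRow_apply_of_forall_gt, ih]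
    exact fun β hβ => restoreRows_apply_eq_zero hl fun γ hγ => hy γ (hβ.trans_le hγ)

theorem restoreRows_apply_of_eq_zero {k l : ℕ} (h : k ≤ l) {α : ι}
    (hα : ∀ j, k ≤ j → j < l → τ j α = 0) (y : ι → K) : restoreRows τ k l y α = y α := by
  induction l, h using Nat.le_induction with
  | base => rw [restoreRows_self]
  | succ l hl ih =>
    rw [restoreRows_succ τ hl, restoreRow_apply_of_eq_zero (hα l hl l.lt_succ_self),
      ih fun j hj hjl => hα j hj (hjl.trans l.lt_succ_self)]

theorem restoreRows_eq_self {k l : ℕ} (h : k ≤ l) {y : ι → K}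
    (hy : ∀ β, y β = 0 ∨ ∀ j, k ≤ j → j < l → τ j β = 0) : restoreRows τ k l y = y := by
  induction l, h using Nat.le_induction with
  | base => rw [restoreRows_self]
  | succ l hl ih =>
    rw [restoreRows_succ τ hl, ih fun β => (hy β).imp_right fun hβ j hj hjl =>
      hβ j hj (hjl.trans l.lt_succ_self)]
    exact restoreRow_eq_self fun β => (hy β).imp_right fun hβ => hβ l hl l.lt_succ_self

theorem restoreRows_indicator_apply {k l : ℕ} (h : k ≤ l) {y : ι → K} {s : Set ι} {α : ι}
    (hα : α ∈ s) (hs : ∀ β, β ∉ s → y β = 0 ∨ ∀ j, k ≤ j → j < l → τ j β = 0) :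
    restoreRows τ k l (s.indicator y) α = restoreRows τ k l y α := by
  have hcompl : restoreRows τ k l (sᶜ.indicator y) = sᶜ.indicator y := by
    refine restoreRows_eq_self h fun β => ?_
    by_cases hβ : β ∈ s
    · exact Or.inl (Set.indicator_of_notMem (Set.notMem_compl_iff.2 hβ) y)
    · rw [Set.indicator_of_mem (Set.mem_compl hβ)]
      exact hs β hβ
  conv_rhs => rw [← Set.indicator_self_add_compl s y, map_add, Pi.add_apply, hcompl,
    Set.indicator_of_notMem (Set.notMem_compl_iff.2 hα), add_zero]

theorem indicator_Iio_restoreRows_apply {k l : ℕ} (h : k ≤ l) (y : ι → K) {d β : ι}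
    (hτ : (∀ j γ, k ≤ j → j < l → d ≤ γ → τ j γ = 0) ∨
      (β < d → ∀ j, k ≤ j → j < l → τ j β = 0)) :
    (Set.Iio d).indicator (restoreRows τ k l y) β =
      restoreRows τ k l ((Set.Iio d).indicator y) β := by
  rcases lt_or_ge β d with hβ | hβ
  · have hmem : β ∈ Set.Iio d := hβ
    rw [Set.indicator_of_mem hmem]
    rcases hτ with hright | hcol
    · exact (restoreRows_indicator_apply h hmem fun γ hγ =>
        Or.inr fun j hj hjl => hright j γ hj hjl (Set.notMem_Iio.1 hγ)).symm
    · rw [restoreRows_apply_of_eq_zero h (hcol hβ), restoreRows_apply_of_eq_zero h (hcol hβ),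
        Set.indicator_of_mem hmem]
  · rw [Set.indicator_of_notMem (Set.notMem_Iio.2 hβ), restoreRows_apply_eq_zero h]
    exact fun γ hγ => Set.indicator_of_notMem (Set.notMem_Iio.2 (hβ.trans hγ)) y

/-- Row `i` of the matrix restored from the rows `τ 0, …, τ (n - 1)`, except that the columns after
`c` are set to zero once the restoration by row `k` has been carried out. -/
noncomputable def truncatedRow (τ : ℕ → ι → K) (n k : ℕ) (c : ι) (i : ℕ) : ι → K :=
  restoreRows τ (k + 1) n ((Set.Iic c).indicator (restoreRows τ (i + 1) (k + 1) (τ i)))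

theorem truncatedRow_apply_eq_restoreRows {n k i : ℕ} {c α : ι} (hik : i ≤ k) (hkn : k < n)
    (hα : α ≤ c) (hτ : ∀ j β, k < j → j < n → c < β → τ j β = 0) :
    truncatedRow τ n k c i α = restoreRows τ (i + 1) n (τ i) α := by
  rw [truncatedRow, restoreRows_indicator_apply hkn (Set.mem_Iic.2 hα),
    restoreRows_restoreRows τ (Nat.succ_le_succ hik) hkn]
  exact fun β hβ => Or.inr fun j hj hjn => hτ j β hj hjn (Set.notMem_Iic.1 hβ)

theorem truncatedRow_apply_right {n k : ℕ} (hkn : k < n) (c : ι) (i : ℕ) :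
    truncatedRow τ n k c i c = restoreRows τ (i + 1) (k + 1) (τ i) c := by
  rw [truncatedRow, restoreRows_apply_of_forall_gt hkn, Set.indicator_of_mem Set.self_mem_Iic]
  exact fun β hβ => Set.indicator_of_notMem (Set.notMem_Iic.2 hβ) _

theorem truncatedRow_self_apply_right {n k : ℕ} (hkn : k < n) (c : ι) :
    truncatedRow τ n k c k c = τ k c := by
  rw [truncatedRow_apply_right hkn, restoreRows_self]

theorem truncatedRow_sub_smul {n k i : ℕ} {c : ι} (hik : i < k) (hkn : k < n) (hc : τ k c ≠ 0) :
    truncatedRow τ n k c i - (truncatedRow τ n k c i c * (τ k c)⁻¹) • truncatedRow τ n k c k =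
      restoreRows τ k n ((Set.Iio c).indicator (restoreRows τ (i + 1) k (τ i))) := by
  rw [truncatedRow_apply_right hkn, restoreRows_eq_restoreRow τ hkn, ← indicator_restoreRow_sub hc,
    ← restoreRows_succ τ hik, map_sub, map_smul, truncatedRow, truncatedRow, restoreRows_self]

theorem restoreRows_indicator_Iio_apply_eq_truncatedRow {i a b n : ℕ} {c₀ c d α : ι}
    (hia : i ≤ a) (hab : a < b) (hbn : b ≤ n) (hcd : c < d) (hα : c₀ ≤ α) (hαc : α ≤ c)
    (hrows : (∀ j β, a < j → j < b → c < β → τ j β = 0) ∨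
      (∀ j β, a < j → j < b → c₀ ≤ β → β < d → τ j β = 0))
    (hcols : (∀ j β, a < j → c < β → β < d → τ j β = 0) ∨
      (∀ j β, i ≤ j → j < b → c < β → β < d → τ j β = 0)) :
    restoreRows τ b n ((Set.Iio d).indicator (restoreRows τ (i + 1) b (τ i))) α =
      truncatedRow τ n a c i α := by
  have hia' : i + 1 ≤ a + 1 := Nat.succ_le_succ hia
  set y := restoreRows τ (i + 1) (a + 1) (τ i) with hy
  have hbetween (β : ι) (hβ : β ∉ Set.Iic c) : (Set.Iio d).indicator y β = 0 ∨
      ∀ j, a + 1 ≤ j → j < n → τ j β = 0 := by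
    have hcβ : c < β := Set.notMem_Iic.1 hβ
    rcases lt_or_ge β d with hβd | hdβ
    · refine hcols.symm.imp (fun h => ?_) fun h j hj _ => h j β hj hcβ hβd
      rw [Set.indicator_of_mem (Set.mem_Iio.2 hβd), hy, restoreRows_apply_of_eq_zero hia']
      · exact h i β le_rfl (hia.trans_lt hab) hcβ hβd
      · exact fun j hj hja => h j β (Nat.le_of_succ_le hj) (hja.trans_le hab) hcβ hβd
    · exact Or.inl (Set.indicator_of_notMem (Set.notMem_Iio.2 hdβ) y)
  calc restoreRows τ b n ((Set.Iio d).indicator (restoreRows τ (i + 1) b (τ i))) α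
      = restoreRows τ b n ((Set.Iio d).indicator (restoreRows τ (a + 1) b y)) α := by
        rw [hy, restoreRows_restoreRows τ hia' hab]
    _ = restoreRows τ b n (restoreRows τ (a + 1) b ((Set.Iio d).indicator y)) α :=
        restoreRows_congr hbn fun β hβ => indicator_Iio_restoreRows_apply hab y <|
          hrows.imp (fun h j γ hj hjb hγ => h j γ hj hjb (hcd.trans_le hγ))
            fun h hβd j hj hjb => h j β hj hjb (hα.trans hβ) hβd
    _ = restoreRows τ (a + 1) n ((Set.Iio d).indicator y) α := by
        rw [restoreRows_restoreRows τ hab hbn]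
    _ = restoreRows τ (a + 1) n ((Set.Iic c).indicator ((Set.Iio d).indicator y)) α :=
        (restoreRows_indicator_apply (hab.trans_le hbn) (Set.mem_Iic.2 hαc) hbetween).symm
    _ = truncatedRow τ n a c i α := by
        rw [Set.indicator_indicator, Set.inter_eq_left.2 (Set.Iic_subset_Iio.2 hcd), truncatedRow]

theorem det_eq_det_mul_of_forall_last_col_eq_mul {R : Type*} [CommRing R] {t : ℕ}
    (A : Matrix (Fin (t + 1)) (Fin (t + 1)) R) (coef : Fin t → R)
    (h : ∀ r, A r.castSucc (Fin.last t) = coef r * A (Fin.last t) (Fin.last t)) :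
    A.det = (Matrix.of fun r q : Fin t =>
      A r.castSucc q.castSucc - coef r * A (Fin.last t) q.castSucc).det *
        A (Fin.last t) (Fin.last t) := by
  set B : Matrix (Fin (t + 1)) (Fin (t + 1)) R := Matrix.of (Fin.snoc
    (fun r q => A r.castSucc q - coef r * A (Fin.last t) q) (A (Fin.last t))) with hB
  have hBcast (r : Fin t) (q : Fin (t + 1)) :
      B r.castSucc q = A r.castSucc q - coef r * A (Fin.last t) q := by simp [hB]
  have hBlast (q : Fin (t + 1)) : B (Fin.last t) q = A (Fin.last t) q := by simp [hB]
  have hdet : A.det = B.det := by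
    refine Matrix.det_eq_of_forall_row_eq_smul_add_const (Fin.snoc coef 0) (Fin.last t)
      (by simp) fun r q => ?_
    induction r using Fin.lastCases with
    | last => simp [hBlast]
    | cast r => simp [hBcast, hBlast]
  rw [hdet, Matrix.det_succ_column B (Fin.last t), Fin.sum_univ_castSucc, Finset.sum_eq_zero,
    zero_add, hBlast, Even.neg_one_pow (by simp), one_mul, mul_comm]
  · congr 2
    ext r q
    simp [hBcast]
  · intro r _
    rw [hBcast, h, sub_self, mul_zero, zero_mul]

namespace IsLacunaryChain

theorem truncatedRow_sub_apply {n t : ℕ} {row : Fin (t + 2) → ℕ} {col : Fin (t + 2) → ι}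
    (h : IsLacunaryChain τ row col) (hn : row (Fin.last (t + 1)) < n) (r q : Fin (t + 1)) :
    truncatedRow τ n (row (Fin.last (t + 1))) (col (Fin.last (t + 1)))
          (row r.castSucc) (col q.castSucc) -
        truncatedRow τ n (row (Fin.last (t + 1))) (col (Fin.last (t + 1)))
            (row r.castSucc) (col (Fin.last (t + 1))) *
          (τ (row (Fin.last (t + 1))) (col (Fin.last (t + 1))))⁻¹ *
          truncatedRow τ n (row (Fin.last (t + 1))) (col (Fin.last (t + 1)))
            (row (Fin.last (t + 1))) (col q.castSucc) =
      truncatedRow τ n (row (Fin.last t).castSucc) (col (Fin.last t).castSucc)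
        (row r.castSucc) (col q.castSucc) := by
  have hle (s : Fin (t + 1)) : s.castSucc ≤ (Fin.last t).castSucc :=
    Fin.castSucc_le_castSucc_iff.2 (Fin.le_last s)
  have hrow₀ : row 0 ≤ row r.castSucc := h.row_strictMono.monotone (Fin.zero_le _)
  have helim := congrFun (truncatedRow_sub_smul (h.row_strictMono (Fin.castSucc_lt_last r)) hn
    (h.ne_zero _ Fin.last_pos.ne')) (col q.castSucc)
  rw [Pi.sub_apply, Pi.smul_apply, smul_eq_mul] at helim
  rw [helim]
  exact restoreRows_indicator_Iio_apply_eq_truncatedRow (c₀ := col 0)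
    (h.row_strictMono.monotone (hle r)) (h.row_strictMono (Fin.castSucc_lt_last _)) hn.le
    (h.col_strictMono (Fin.castSucc_lt_last _)) (h.col_strictMono.monotone (Fin.zero_le _))
    (h.col_strictMono.monotone (hle q)) (h.zero_rows (Fin.last t))
    ((h.zero_cols (Fin.last t)).imp_right fun hz j β hj => hz j β (hrow₀.trans hj))

theorem det_truncatedRow {n t : ℕ} {row : Fin (t + 1) → ℕ} {col : Fin (t + 1) → ι}
    (h : IsLacunaryChain τ row col) (hn : row (Fin.last t) < n) :
    (Matrix.of fun r q => truncatedRow τ n (row (Fin.last t)) (col (Fin.last t))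
      (row r) (col q)).det = ∏ s, τ (row s) (col s) := by
  induction t with
  | zero =>
    rw [Matrix.det_fin_one, Fin.prod_univ_one]
    exact truncatedRow_self_apply_right hn (col 0)
  | succ t ih =>
    set k := row (Fin.last (t + 1))
    set c := col (Fin.last (t + 1))
    have hne : τ k c ≠ 0 := h.ne_zero _ Fin.last_pos.ne'
    have hkc : truncatedRow τ n k c k c = τ k c := truncatedRow_self_apply_right hn c
    refine (det_eq_det_mul_of_forall_last_col_eq_mul _
      (fun r => truncatedRow τ n k c (row r.castSucc) c * (τ k c)⁻¹) fun r => ?_).trans ?_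
    · change _ = _ * truncatedRow τ n k c k c
      rw [hkc, inv_mul_cancel_right₀ hne]
      rfl
    · rw [Fin.prod_univ_castSucc,
        ← ih h.castSucc ((h.row_strictMono (Fin.castSucc_lt_last _)).trans hn)]
      exact congrArg₂ (· * ·)
        (congrArg Matrix.det (Matrix.ext fun r q => h.truncatedRow_sub_apply hn r q)) hkc

end IsLacunaryChain

end Restoration

section Reduction

variable {m p : ℕ}

theorem reductionStep_apply (b : Fin m × Fin p) (X : Matrix (Fin m) (Fin p) ℝ) (i : Fin m)
    (α : Fin p) : reductionStep b X i α =
      if i < b.1 ∧ α < b.2 then X i α - X i b.2 * (X b.1 b.2)⁻¹ * X b.1 α else X i α := by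
  unfold reductionStep
  by_cases h : X b.1 b.2 = 0 <;> simp [h]

/-- The reduction steps with pivots in row `j` and in the columns listed in `l`, last one first. -/
noncomputable def reduceRow (j : Fin m) (l : List (Fin p)) (X : Matrix (Fin m) (Fin p) ℝ) :
    Matrix (Fin m) (Fin p) ℝ :=
  l.foldr (fun β => reductionStep (j, β)) X

theorem reduceRow_cons (j : Fin m) (c : Fin p) (l : List (Fin p)) (X : Matrix (Fin m) (Fin p) ℝ) :
    reduceRow j (c :: l) X = reductionStep (j, c) (reduceRow j l X) := rfl

theorem cauchonReduction_eq_foldr_reduceRow (M : Matrix (Fin m) (Fin p) ℝ) :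
    cauchonReduction M =
      (List.finRange m).foldr (fun j => reduceRow j (List.finRange p)) M := by
  simp only [cauchonReduction, boxes, List.product, List.foldr_flatMap, List.foldr_map]
  rfl

theorem reduceRow_of_le {i j : Fin m} (h : j ≤ i) (l : List (Fin p))
    (X : Matrix (Fin m) (Fin p) ℝ) : reduceRow j l X i = X i := by
  induction l with
  | nil => rfl
  | cons c l ih =>
    ext α
    rw [reduceRow_cons, reductionStep_apply, if_neg fun h' => h.not_gt h'.1, ih]

theorem eq_reduceRow_add_mul_sum {i j : Fin m} (h : i < j) {l : List (Fin p)}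
    (hl : l.Pairwise (· < ·)) (X : Matrix (Fin m) (Fin p) ℝ) (α : Fin p) :
    X i α = reduceRow j l X i α +
      X j α * ∑ β ∈ l.toFinset with α < β, reduceRow j l X i β * (X j β)⁻¹ := by
  induction l with
  | nil => simp [reduceRow]
  | cons c l ih =>
    obtain ⟨hc, hl⟩ := List.pairwise_cons.1 hl
    have hstep (β : Fin p) : reduceRow j (c :: l) X i β = if β < c then
        reduceRow j l X i β - reduceRow j l X i c * (X j c)⁻¹ * X j β
        else reduceRow j l X i β := by
      simp only [reduceRow_cons, reductionStep_apply, h, true_and, reduceRow_of_le le_rfl]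
    have hsame (β : Fin p) (hβ : c ≤ β) : reduceRow j (c :: l) X i β = reduceRow j l X i β := by
      rw [hstep, if_neg hβ.not_gt]
    have hsum : ∑ β ∈ l.toFinset with α < β, reduceRow j (c :: l) X i β * (X j β)⁻¹ =
        ∑ β ∈ l.toFinset with α < β, reduceRow j l X i β * (X j β)⁻¹ :=
      Finset.sum_congr rfl fun β hβ => by
        rw [hsame β (hc β (List.mem_toFinset.1 (Finset.mem_filter.1 hβ).1)).le]
    have hcl : c ∉ ({β ∈ l.toFinset | α < β} : Finset (Fin p)) := fun hmem =>
      lt_irrefl c (hc c (List.mem_toFinset.1 (Finset.mem_filter.1 hmem).1))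
    rw [ih hl, List.toFinset_cons, Finset.filter_insert]
    split_ifs with hαc
    · rw [Finset.sum_insert hcl, hsum, hsame c le_rfl, hstep, if_pos hαc]
      ring
    · rw [hsum, hsame α (not_lt.1 hαc)]

theorem restoreRow_reduceRow {i j : Fin m} (h : i < j) (X : Matrix (Fin m) (Fin p) ℝ) :
    restoreRow (X j) (reduceRow j (List.finRange p) X i) = X i := by
  ext α
  have hIoi : ({β ∈ (List.finRange p).toFinset | α < β} : Finset (Fin p)) = Finset.Ioi α := by
    ext β
    simp
  rw [restoreRow_apply, eq_reduceRow_add_mul_sum h (List.pairwise_lt_finRange p) X α, hIoi]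

/-- The matrix obtained from `M` by the reduction steps with pivots in the rows from `k` on. -/
noncomputable def reduceRowsFrom (M : Matrix (Fin m) (Fin p) ℝ) (k : ℕ) :
    Matrix (Fin m) (Fin p) ℝ :=
  ((List.finRange m).drop k).foldr (fun j => reduceRow j (List.finRange p)) M

theorem reduceRowsFrom_zero (M : Matrix (Fin m) (Fin p) ℝ) :
    reduceRowsFrom M 0 = cauchonReduction M := by
  rw [reduceRowsFrom, List.drop_zero, cauchonReduction_eq_foldr_reduceRow]

theorem reduceRowsFrom_self (M : Matrix (Fin m) (Fin p) ℝ) : reduceRowsFrom M m = M := by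
  rw [reduceRowsFrom, List.drop_of_length_le (by simp), List.foldr_nil]

theorem reduceRowsFrom_coe (M : Matrix (Fin m) (Fin p) ℝ) (k : Fin m) :
    reduceRowsFrom M k = reduceRow k (List.finRange p) (reduceRowsFrom M (k + 1)) := by
  rw [reduceRowsFrom, List.drop_eq_getElem_cons (by simp), List.foldr_cons, List.getElem_finRange]
  rfl

theorem reduceRowsFrom_apply_of_le (M : Matrix (Fin m) (Fin p) ℝ) {k : ℕ} {i : Fin m}
    (h : k ≤ i + 1) : reduceRowsFrom M k i = cauchonReduction M i := by
  induction k with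
  | zero => rw [reduceRowsFrom_zero]
  | succ k ih =>
    have hki : k ≤ i := Nat.le_of_succ_le_succ h
    rw [← ih (Nat.le_of_succ_le h), reduceRowsFrom_coe M ⟨k, hki.trans_lt i.2⟩,
      reduceRow_of_le hki]

/-- The rows of the Cauchon reduction of `M`, continued by zero rows. -/
noncomputable def reducedRows (M : Matrix (Fin m) (Fin p) ℝ) : ℕ → Fin p → ℝ :=
  Function.extend Fin.val (cauchonReduction M).row 0

theorem reducedRows_coe (M : Matrix (Fin m) (Fin p) ℝ) (i : Fin m) :
    reducedRows M i = cauchonReduction M i :=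
  Fin.val_injective.extend_apply _ _ i

theorem restoreRows_reducedRows (M : Matrix (Fin m) (Fin p) ℝ) (i : Fin m) :
    restoreRows (reducedRows M) (i + 1) m (reducedRows M i) = M i := by
  suffices ∀ k, (i : ℕ) + 1 ≤ k → k ≤ m →
      restoreRows (reducedRows M) (i + 1) k (reducedRows M i) = reduceRowsFrom M k i by
    rw [this m i.2 le_rfl, reduceRowsFrom_self]
  intro k hk
  induction k, hk using Nat.le_induction with
  | base => intro _; rw [restoreRows_self, reduceRowsFrom_apply_of_le M le_rfl, reducedRows_coe]
  | succ k hk ih =>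
    intro hkm
    have hpivot : reducedRows M k = reduceRowsFrom M (k + 1) ⟨k, hkm⟩ := by
      have hrow : reduceRowsFrom M (k + 1) ⟨k, hkm⟩ = cauchonReduction M ⟨k, hkm⟩ :=
        reduceRowsFrom_apply_of_le M le_rfl
      exact (reducedRows_coe M ⟨k, hkm⟩).trans hrow.symm
    rw [restoreRows_succ _ hk, ih (Nat.le_of_succ_le hkm), hpivot, reduceRowsFrom_coe M ⟨k, hkm⟩]
    exact restoreRow_reduceRow hk _

end Reduction

section Lacunary

variable {m p : ℕ} {C : CauchonDiagram m p} {M : Matrix (Fin m) (Fin p) ℝ}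

theorem reducedRows_apply_eq_zero {i : Fin m} {α : Fin p}
    (h : ∀ b ∈ C.black, (i, α) < b → cauchonReduction M b.1 b.2 = 0) {j : ℕ} {β : Fin p}
    (hlt : ((i : ℕ), α) < (j, β)) (hb : ∀ hj : j < m, (⟨j, hj⟩, β) ∈ C.black) :
    reducedRows M j β = 0 := by
  by_cases hj : j < m
  · have hlt' : (i, α) < (⟨j, hj⟩, β) := hlt
    exact (congrFun (reducedRows_coe M ⟨j, hj⟩) β).trans (h _ (hb hj) hlt')
  · rw [reducedRows, Function.extend_apply' _ _ _ (by rintro ⟨k, rfl⟩; exact hj k.2)]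
    rfl

namespace LacunarySeq

theorem head_lt (S : LacunarySeq C) {s : Fin (S.t + 1)} (hs : s ≠ 0) :
    (S.row 0, S.col 0) < (S.row s, S.col s) :=
  Prod.mk_lt_mk_of_lt_of_le (S.row_strictMono (Fin.pos_iff_ne_zero.2 hs))
    (S.col_strictMono.monotone (Fin.zero_le s))

theorem isLacunaryChain_reducedRows (S : LacunarySeq C)
    (h : ∀ b, (S.row 0, S.col 0) < b → (cauchonReduction M b.1 b.2 = 0 ↔ b ∈ C.black)) :
    IsLacunaryChain (reducedRows M) (fun s => (S.row s : ℕ)) S.col := by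
  have hrow₀ (s) : (S.row 0 : ℕ) ≤ S.row s := S.row_strictMono.monotone (Fin.zero_le s)
  have hcol₀ (s) : S.col 0 ≤ S.col s := S.col_strictMono.monotone (Fin.zero_le s)
  have hblack : ∀ b ∈ C.black, (S.row 0, S.col 0) < b → cauchonReduction M b.1 b.2 = 0 :=
    fun b hb hlt => (h b hlt).2 hb
  refine ⟨S.row_strictMono, S.col_strictMono, fun s hs => ?_, fun s => ?_, fun s => ?_⟩
  · rw [reducedRows_coe]
    exact fun hzero => S.white s hs ((h _ (S.head_lt hs)).1 hzero)
  · exact (S.black_rows s).imp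
      (fun hb j β hj hj' hβ => reducedRows_apply_eq_zero hblack
        (Prod.mk_lt_mk_of_lt_of_le ((hrow₀ _).trans_lt hj) ((hcol₀ _).trans hβ.le))
        fun hjm => hb ⟨j, hjm⟩ β hj hj' hβ)
      (fun hb j β hj hj' hβ hβ' => reducedRows_apply_eq_zero hblack
        (Prod.mk_lt_mk_of_lt_of_le ((hrow₀ _).trans_lt hj) hβ)
        fun hjm => hb ⟨j, hjm⟩ β hj hj' hβ hβ')
  · exact (S.black_cols s).imp
      (fun hb j β hj hβ hβ' => reducedRows_apply_eq_zero hblack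
        (Prod.mk_lt_mk_of_lt_of_le ((hrow₀ _).trans_lt hj) ((hcol₀ _).trans hβ.le))
        fun hjm => hb ⟨j, hjm⟩ β hj hβ hβ')
      (fun hb j β hj hj' hβ hβ' => reducedRows_apply_eq_zero hblack
        (Prod.mk_lt_mk_of_le_of_lt hj ((hcol₀ _).trans_lt hβ))
        fun hjm => hb ⟨j, hjm⟩ β hj' hβ hβ')

theorem minor_eq_prod (S : LacunarySeq C)
    (h : ∀ b, (S.row 0, S.col 0) < b → (cauchonReduction M b.1 b.2 = 0 ↔ b ∈ C.black)) :
    S.minor M = ∏ s, cauchonReduction M (S.row s) (S.col s) := by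
  have hrow (s) : S.row s ≤ S.row (Fin.last S.t) := S.row_strictMono.monotone (Fin.le_last s)
  have hcol (s) : S.col s ≤ S.col (Fin.last S.t) := S.col_strictMono.monotone (Fin.le_last s)
  have hafter (j : ℕ) (β : Fin p) (hj : (S.row (Fin.last S.t) : ℕ) < j) (hjm : j < m)
      (hβ : S.col (Fin.last S.t) < β) : reducedRows M j β = 0 :=
    reducedRows_apply_eq_zero (fun b hb hlt => (h b hlt).2 hb)
      (Prod.mk_lt_mk_of_lt_of_le (lt_of_le_of_lt (hrow 0) hj) ((hcol 0).trans hβ.le))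
      fun _ => S.black_after ⟨j, hjm⟩ β hj hβ
  simp only [← reducedRows_coe]
  rw [← (S.isLacunaryChain_reducedRows h).det_truncatedRow (S.row (Fin.last S.t)).2, minor]
  congr 1
  ext r q
  rw [Matrix.submatrix_apply, Matrix.of_apply, truncatedRow_apply_eq_restoreRows (hrow r)
    (S.row (Fin.last S.t)).2 (hcol q) hafter, restoreRows_reducedRows]

theorem minor_eq_head_mul_prod (S : LacunarySeq C)
    (h : ∀ b, (S.row 0, S.col 0) < b → (cauchonReduction M b.1 b.2 = 0 ↔ b ∈ C.black)) :
    S.minor M = cauchonReduction M (S.row 0) (S.col 0) *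
      ∏ s : Fin S.t, cauchonReduction M (S.row s.succ) (S.col s.succ) := by
  rw [S.minor_eq_prod h, Fin.prod_univ_succ]

end LacunarySeq

variable {L : Fin m → Fin p → LacunarySeq C}

theorem isCauchonMatrix_cauchonReduction_of_minor (hL : ∀ j β, (L j β).StartsAt j β)
    (hM : ∀ j β, (L j β).minor M = 0 ↔ (j, β) ∈ C.black) :
    IsCauchonMatrix C (cauchonReduction M) := by
  suffices ∀ b : Fin m × Fin p, cauchonReduction M b.1 b.2 = 0 ↔ b ∈ C.black from
    fun i α => this (i, α)
  intro b
  induction b using WellFoundedGT.induction with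
  | ind b ih =>
    obtain ⟨hrow, hcol⟩ := hL b.1 b.2
    set S := L b.1 b.2 with hS
    have hhead : (S.row 0, S.col 0) = b := by rw [hrow, hcol]
    have hprod : ∏ s : Fin S.t, cauchonReduction M (S.row s.succ) (S.col s.succ) ≠ 0 :=
      Finset.prod_ne_zero_iff.2 fun s _ hzero => S.white _ s.succ_ne_zero <|
        (ih _ (hhead ▸ S.head_lt s.succ_ne_zero)).1 hzero
    rw [← hM, ← hS, S.minor_eq_head_mul_prod (hhead ▸ ih), hrow, hcol, mul_eq_zero,
      or_iff_left hprod]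

theorem HasMinorPattern.minor_eq_zero_iff (hM : HasMinorPattern L M) (j : Fin m) (β : Fin p) :
    (L j β).minor M = 0 ↔ (j, β) ∈ C.black :=
  ⟨fun hzero => by_contra fun hw => ((hM j β).2 hw).ne' hzero, (hM j β).1⟩

theorem HasMinorPattern.cauchonReduction_nonneg (hL : ∀ j β, (L j β).StartsAt j β)
    (hM : HasMinorPattern L M) (i : Fin m) (α : Fin p) : 0 ≤ cauchonReduction M i α := by
  have hC := isCauchonMatrix_cauchonReduction_of_minor hL hM.minor_eq_zero_iff
  suffices ∀ b : Fin m × Fin p, 0 ≤ cauchonReduction M b.1 b.2 from this (i, α)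
  intro b
  induction b using WellFoundedGT.induction with
  | ind b ih =>
    by_cases hb : b ∈ C.black
    · exact ((hC b.1 b.2).2 hb).ge
    obtain ⟨hrow, hcol⟩ := hL b.1 b.2
    have hpos := (hM b.1 b.2).2 hb
    set S := L b.1 b.2
    have hhead : (S.row 0, S.col 0) = b := by rw [hrow, hcol]
    have hprod : 0 ≤ ∏ s : Fin S.t, cauchonReduction M (S.row s.succ) (S.col s.succ) :=
      Finset.prod_nonneg fun s _ => ih _ (hhead ▸ S.head_lt s.succ_ne_zero)
    rw [S.minor_eq_head_mul_prod fun b _ => hC b.1 b.2, hrow, hcol] at hpos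
    exact (pos_of_mul_pos_left hpos hprod).le

end Lacunary

end TNNCells

theorem proposition4p1_general {m p : ℕ} (C : TNNCells.CauchonDiagram m p)
    (M : Matrix (Fin m) (Fin p) ℝ)
    (L : Fin m → Fin p → TNNCells.LacunarySeq C) (hL : ∀ j β, (L j β).StartsAt j β) :
    ((TNNCells.IsCauchonMatrix C (TNNCells.cauchonReduction M) ∨
        ∀ j β, (L j β).minor M = 0 ↔ (j, β) ∈ C.black) →
      ∀ S : TNNCells.LacunarySeq C,
        S.minor M = ∏ s, TNNCells.cauchonReduction M (S.row s) (S.col s)) ∧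
    (TNNCells.HasMinorPattern L M →
      ∀ i α, 0 ≤ TNNCells.cauchonReduction M i α ∧
        (TNNCells.cauchonReduction M i α = 0 ↔ (i, α) ∈ C.black)) := by
  have hCauchon := TNNCells.isCauchonMatrix_cauchonReduction_of_minor (M := M) hL
  refine ⟨fun h S => S.minor_eq_prod fun b _ => h.elim id hCauchon b.1 b.2, fun hM i α => ?_⟩
  exact ⟨hM.cauchonReduction_nonneg hL i α, hCauchon hM.minor_eq_zero_iff i α⟩

theorem proposition4p1 {m p : ℕ} (C : TNNCells.CauchonDiagram m p)
    (M : Matrix (Fin m) (Fin p) ℝ)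
    (L : Fin m → Fin p → TNNCells.LacunarySeq C) (hL : ∀ j β, (L j β).StartsAt j β) :
    ((M ∈ TNNCells.tnnCell C ∨ TNNCells.HasMinorPattern L M) →
      ∀ S : TNNCells.LacunarySeq C,
        S.minor M = ∏ s, TNNCells.cauchonReduction M (S.row s) (S.col s)) ∧
    (TNNCells.HasMinorPattern L M →
      ∀ i α, 0 ≤ TNNCells.cauchonReduction M i α ∧
        (TNNCells.cauchonReduction M i α = 0 ↔ (i, α) ∈ C.black)) :=
  (proposition4p1_general C M L hL).imp_left fun h hM =>
    h (hM.imp And.right TNNCells.HasMinorPattern.minor_eq_zero_iff)
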